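/- **Theorem 2.1.** Let $G$ be a finite group with unit $e$ and $H$ a normal subgroup of $G$. Let $\mathcal F_{H,\mathrm{loc}}$ be the unital associative complex algebra (with unit $I$) generated by $\delta_g(x)$, $\rho_h(l)$ ($g\in G$, $h\in H$, $x\in\mathbb Z$, $l\in\mathbb Z+\frac12$) subject to $$\sum_{g\in G}\delta_g(x)=I=\rho_e(l),\quad \delta_{g_1}(x)\delta_{g_2}(x)=\delta_{g_1,g_2}\,\delta_{g_1}(x),\quad \rho_{h_1}(l)\rho_{h_2}(l)=\rho_{h_1h_2}(l),\quad \delta_{g_1}(x)\delta_{g_2}(x')=\delta_{g_2}(x')\delta_{g_1}(x),$$ $$\rho_h(l)\delta_g(x)=\begin{cases}\delta_{hg}(x)\rho_h(l),& l<x,\\ \delta_g(x)\rho_h(l),& l>x,\end{cases}\qquad \rho_{h_1}(l)\rho_{h_2}(l')=\begin{cases}\rho_{h_2}(l')\rho_{h_2^{-1}h_1h_2}(l),& l>l',\\ \rho_{h_1h_2h_1^{-1}}(l')\rho_{h_1}(l),& l<l',\end{cases}$$ with the involution determined by $\delta_g(x)^*=\delta_g(x)$, $\rho_h(l)^*=\rho_{h^{-1}}(l)$.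 Let $\mathcal F_H$ be its C\*-completion, i.e. the C\*-inductive limit of the finite-dimensional C\*-algebras generated by the $\delta_g(x)$, $\rho_h(l)$ with $x,l$ in a finite interval (equivalently, the completion of $\mathcal F_{H,\mathrm{loc}}$ in its largest C\*-seminorm). Let $D(H;G)$ be the crossed product of the algebra of complex functions on $H$ by $\mathbb CG$ with respect to the adjoint action; it has the linear basis $(h,g)$, $h\in H$, $g\in G$, with product $(h_1,g_1)(h_2,g_2)=\delta_{h_1g_1,g_1h_2}(h_1,g_1g_2)$, coproduct $\Delta(h,g)=\sum_{t\in H}(t,g)\otimes(t^{-1}h,g)$ and counit $\varepsilon(h,g)=\delta_{h,e}$. It acts continuously on $\mathcal F_H$, making it a $D(H;G)$-module algebra, by $$(h,g)\,\delta_f(x)=\delta_{h,e}\,\delta_{gf}(x),\qquad (h,g)\,\rho_t(l)=\delta_{h,gtg^{-1}}\,\rho_h(l)\qquad(f\in G,\ t\in H).$$ Let $$\mathcal A_{(H,G)}=\{F\in\mathcal F_H:\ a(F)=\varepsilon(a)F\ \text{ for all } a\in D(H;G)\}$$ be the observable algebra, and put, for $h\in H$, $g\in G$, $x\in\mathbb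 Z$, $l\in\mathbb Z+\frac12$, $$v_h(x)=\sum_{k\in G}\rho_{kh^{-1}k^{-1}}\big(x-\tfrac12\big)\,\delta_k(x)\,\rho_{khk^{-1}}\big(x+\tfrac12\big),\qquad w_g(l)=\sum_{k\in G}\delta_k\big(l-\tfrac12\big)\,\delta_{kg}\big(l+\tfrac12\big).$$ Then $\mathcal A_{(H,G)}$ is the unital C\*-subalgebra of $\mathcal F_H$ generated by $\{v_h(x),\,w_g(l): h\in H,\ g\in G,\ x\in\mathbb Z,\ l\in\mathbb Z+\frac12\}$. -/

import Mathlib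

noncomputable section

namespace GSpin

universe u

section LocalField

variable {G : Type u} [Group G]

/-- Symbols for the generators `δ_g(x)` and `ρ_h(l)`. The half-integer `l = n + 1/2` is indexed by
the integer `n`: `rho h n` stands for `ρ_h(n + 1/2)`. -/
inductive Gen (H : Subgroup G) : Type u
  | delta (g : G) (x : ℤ) : Gen H
  | rho (h : H) (n : ℤ) : Gen H

/-- The generator `δ_g(x)` in the free algebra. -/
abbrev fδ {H : Subgroup G} (g : G) (x : ℤ) : FreeAlgebra ℂ (Gen H) := FreeAlgebra.ι ℂ (.delta g x)

/-- The generator `ρ_h(n + 1/2)` in the free algebra. -/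
abbrev fρ {H : Subgroup G} (h : H) (n : ℤ) : FreeAlgebra ℂ (Gen H) := FreeAlgebra.ι ℂ (.rho h n)

variable [Fintype G]

/-- The defining relations of the local field algebra. -/
inductive Rel (H : Subgroup G) : FreeAlgebra ℂ (Gen H) → FreeAlgebra ℂ (Gen H) → Prop
  | sum_delta (x : ℤ) : Rel H (∑ g, fδ g x) 1
  | rho_one (n : ℤ) : Rel H (fρ 1 n) 1
  | delta_mul_self (g : G) (x : ℤ) : Rel H (fδ g x * fδ g x) (fδ g x)
  | delta_mul_ne (g₁ g₂ : G) (x : ℤ) (hg : g₁ ≠ g₂) : Rel H (fδ g₁ x * fδ g₂ x) 0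
  | rho_mul (h₁ h₂ : H) (n : ℤ) : Rel H (fρ h₁ n * fρ h₂ n) (fρ (h₁ * h₂) n)
  | delta_comm (g₁ g₂ : G) (x x' : ℤ) : Rel H (fδ g₁ x * fδ g₂ x') (fδ g₂ x' * fδ g₁ x)
  | rho_delta_lt (h : H) (g : G) (n x : ℤ) (hl : (n : ℚ) + 1 / 2 < x) :
      Rel H (fρ h n * fδ g x) (fδ (h * g) x * fρ h n)
  | rho_delta_gt (h : H) (g : G) (n x : ℤ) (hl : (n : ℚ) + 1 / 2 > x) :
      Rel H (fρ h n * fδ g x) (fδ g x * fρ h n)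
  | rho_rho_gt (h₁ h₂ : H) (n n' : ℤ) (hl : (n : ℚ) + 1 / 2 > (n' : ℚ) + 1 / 2) :
      Rel H (fρ h₁ n * fρ h₂ n') (fρ h₂ n' * fρ (h₂⁻¹ * h₁ * h₂) n)
  | rho_rho_lt (h₁ h₂ : H) (n n' : ℤ) (hl : (n : ℚ) + 1 / 2 < (n' : ℚ) + 1 / 2) :
      Rel H (fρ h₁ n * fρ h₂ n') (fρ (h₁ * h₂ * h₁⁻¹) n' * fρ h₁ n)

/-- The local field algebra determined by `H`: the unital complex algebra with generators `δ_g(x)`,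
`ρ_h(l)` subject to the relations `Rel`. -/
def FLoc (H : Subgroup G) : Type u := RingQuot (Rel H)

namespace FLoc

variable {H : Subgroup G}

instance : Ring (FLoc H) := inferInstanceAs (Ring (RingQuot (Rel H)))
instance : Algebra ℂ (FLoc H) := inferInstanceAs (Algebra ℂ (RingQuot (Rel H)))

/-- The quotient map from the free algebra. -/
def mk : FreeAlgebra ℂ (Gen H) →ₐ[ℂ] FLoc H := RingQuot.mkAlgHom ℂ (Rel H)

theorem mk_rel {a b : FreeAlgebra ℂ (Gen H)} (h : Rel H a b) : mk a = mk b :=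
  RingQuot.mkAlgHom_rel ℂ h

theorem mk_surjective : Function.Surjective (mk (H := H)) := RingQuot.mkAlgHom_surjective ℂ _

/-- `δ_g(x)` in the local field algebra. -/
def δ (g : G) (x : ℤ) : FLoc H := mk (fδ g x)

/-- `ρ_h(n + 1/2)` in the local field algebra. -/
def ρ (h : H) (n : ℤ) : FLoc H := mk (fρ h n)

/-- A map on generators that respects the relations extends to an algebra homomorphism. -/
def lift {B : Type*} [Ring B] [Algebra ℂ B] (f : Gen H → B)
    (hf : ∀ ⦃a b⦄, Rel H a b → FreeAlgebra.lift ℂ f a = FreeAlgebra.lift ℂ f b) :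
    FLoc H →ₐ[ℂ] B :=
  RingQuot.liftAlgHom ℂ ⟨FreeAlgebra.lift ℂ f, hf⟩

theorem lift_mk {B : Type*} [Ring B] [Algebra ℂ B] (f : Gen H → B)
    (hf : ∀ ⦃a b⦄, Rel H a b → FreeAlgebra.lift ℂ f a = FreeAlgebra.lift ℂ f b) (a) :
    lift f hf (mk a) = FreeAlgebra.lift ℂ f a :=
  RingQuot.liftAlgHom_mkAlgHom_apply ℂ _ hf a

theorem lift_δ {B : Type*} [Ring B] [Algebra ℂ B] (f : Gen H → B)
    (hf : ∀ ⦃a b⦄, Rel H a b → FreeAlgebra.lift ℂ f a = FreeAlgebra.lift ℂ f b) (g : G) (x : ℤ) :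
    lift f hf (δ g x) = f (.delta g x) := by
  rw [δ, lift_mk, FreeAlgebra.lift_ι_apply]

theorem lift_ρ {B : Type*} [Ring B] [Algebra ℂ B] (f : Gen H → B)
    (hf : ∀ ⦃a b⦄, Rel H a b → FreeAlgebra.lift ℂ f a = FreeAlgebra.lift ℂ f b) (h : H) (n : ℤ) :
    lift f hf (ρ h n) = f (.rho h n) := by
  rw [ρ, lift_mk, FreeAlgebra.lift_ι_apply]

@[elab_as_elim]
theorem induction {C : FLoc H → Prop} (a : FLoc H)
    (algebraMap : ∀ c : ℂ, C (algebraMap ℂ (FLoc H) c))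
    (delta : ∀ g x, C (δ g x)) (rho : ∀ h n, C (ρ h n))
    (mul : ∀ a b, C a → C b → C (a * b)) (add : ∀ a b, C a → C b → C (a + b)) : C a := by
  obtain ⟨a, rfl⟩ := mk_surjective a
  induction a using FreeAlgebra.induction with
  | grade0 c => rw [AlgHom.commutes]; exact algebraMap c
  | grade1 x =>
    cases x with
    | delta g x => exact delta g x
    | rho h n => exact rho h n
  | mul a b ha hb => rw [map_mul]; exact mul _ _ ha hb
  | add a b ha hb => rw [map_add]; exact add _ _ ha hb

theorem sum_δ (x : ℤ) : ∑ g, (δ g x : FLoc H) = 1 := by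
  simpa [δ] using mk_rel (Rel.sum_delta (H := H) x)
theorem ρ_one (n : ℤ) : (ρ 1 n : FLoc H) = 1 := by
  simpa [ρ] using mk_rel (Rel.rho_one (H := H) n)
theorem δ_mul_self (g : G) (x : ℤ) : (δ g x * δ g x : FLoc H) = δ g x := by
  simpa [δ] using mk_rel (Rel.delta_mul_self (H := H) g x)
theorem δ_mul_ne {g₁ g₂ : G} (x : ℤ) (h : g₁ ≠ g₂) : (δ g₁ x * δ g₂ x : FLoc H) = 0 := by
  simpa [δ] using mk_rel (Rel.delta_mul_ne (H := H) g₁ g₂ x h)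
theorem ρ_mul (h₁ h₂ : H) (n : ℤ) : ρ h₁ n * ρ h₂ n = ρ (h₁ * h₂) n := by
  simpa [ρ] using mk_rel (Rel.rho_mul h₁ h₂ n)
theorem δ_comm (g₁ g₂ : G) (x x' : ℤ) : (δ g₁ x * δ g₂ x' : FLoc H) = δ g₂ x' * δ g₁ x := by
  simpa [δ] using mk_rel (Rel.delta_comm (H := H) g₁ g₂ x x')
theorem ρ_δ_lt (h : H) (g : G) {n x : ℤ} (hl : (n : ℚ) + 1 / 2 < x) :
    ρ h n * δ g x = δ (h * g) x * ρ h n := by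
  simpa [δ, ρ] using mk_rel (Rel.rho_delta_lt h g n x hl)
theorem ρ_δ_gt (h : H) (g : G) {n x : ℤ} (hl : (n : ℚ) + 1 / 2 > x) :
    ρ h n * δ g x = δ g x * ρ h n := by
  simpa [δ, ρ] using mk_rel (Rel.rho_delta_gt h g n x hl)
theorem ρ_ρ_gt (h₁ h₂ : H) {n n' : ℤ} (hl : (n : ℚ) + 1 / 2 > (n' : ℚ) + 1 / 2) :
    ρ h₁ n * ρ h₂ n' = ρ h₂ n' * ρ (h₂⁻¹ * h₁ * h₂) n := by
  simpa [ρ] using mk_rel (Rel.rho_rho_gt h₁ h₂ n n' hl)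
theorem ρ_ρ_lt (h₁ h₂ : H) {n n' : ℤ} (hl : (n : ℚ) + 1 / 2 < (n' : ℚ) + 1 / 2) :
    ρ h₁ n * ρ h₂ n' = ρ (h₁ * h₂ * h₁⁻¹) n' * ρ h₁ n := by
  simpa [ρ] using mk_rel (Rel.rho_rho_lt h₁ h₂ n n' hl)

end FLoc

/-! ### The involution -/

/-- The opposite algebra with scalars acting through complex conjugation: algebra homomorphisms
`A → ConjOp A` are the conjugate-linear antimultiplicative maps `A → A`. -/
def ConjOp (A : Type*) : Type _ := Aᵐᵒᵖ

instance (A : Type*) [Ring A] : Ring (ConjOp A) := inferInstanceAs (Ring Aᵐᵒᵖ)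

instance (A : Type*) [Ring A] [Algebra ℂ A] : Algebra ℂ (ConjOp A) :=
  RingHom.toAlgebra' ((algebraMap ℂ Aᵐᵒᵖ).comp (starRingEnd ℂ)) fun c x =>
    Algebra.commutes (R := ℂ) (A := Aᵐᵒᵖ) (starRingEnd ℂ c) x

/-- The identity map `A → ConjOp A`. -/
def ConjOp.op {A : Type*} [Ring A] : A ≃+ ConjOp A := MulOpposite.opAddEquiv

theorem ConjOp.op_mul_op {A : Type*} [Ring A] (x y : A) : op x * op y = op (y * x) := rfl

theorem ConjOp.op_one {A : Type*} [Ring A] : op (1 : A) = 1 := rfl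

theorem ConjOp.symm_mul {A : Type*} [Ring A] (x y : ConjOp A) :
    op.symm (x * y) = op.symm y * op.symm x := rfl

theorem ConjOp.symm_algebraMap {A : Type*} [Ring A] [Algebra ℂ A] (c : ℂ) :
    op.symm (algebraMap ℂ (ConjOp A) c) = algebraMap ℂ A (star c) := rfl

namespace FLoc

variable {H : Subgroup G}

open ConjOp

/-- The adjoints of the generators: `δ_g(x)* = δ_g(x)` and `ρ_h(l)* = ρ_{h⁻¹}(l)`. -/
def starGen : Gen H → ConjOp (FLoc H)
  | .delta g x => op (δ g x)
  | .rho h n => op (ρ h⁻¹ n)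

theorem starGen_rel ⦃a b : FreeAlgebra ℂ (Gen H)⦄ (hab : Rel H a b) :
    FreeAlgebra.lift ℂ (starGen (H := H)) a = FreeAlgebra.lift ℂ (starGen (H := H)) b := by
  cases hab with
  | sum_delta x =>
    simp only [map_sum, FreeAlgebra.lift_ι_apply, map_one, starGen]
    rw [← map_sum, sum_δ, op_one]
  | rho_one n =>
    simp only [FreeAlgebra.lift_ι_apply, map_one, starGen, inv_one, ρ_one, op_one]
  | delta_mul_self g x =>
    simp only [map_mul, FreeAlgebra.lift_ι_apply, starGen, op_mul_op, δ_mul_self]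
  | delta_mul_ne g₁ g₂ x hg =>
    simp only [map_mul, FreeAlgebra.lift_ι_apply, starGen, op_mul_op, δ_mul_ne x hg.symm, map_zero]
  | rho_mul h₁ h₂ n =>
    simp only [map_mul, FreeAlgebra.lift_ι_apply, starGen, op_mul_op, ρ_mul, mul_inv_rev]
  | delta_comm g₁ g₂ x x' =>
    simp only [map_mul, FreeAlgebra.lift_ι_apply, starGen, op_mul_op, δ_comm g₂ g₁]
  | rho_delta_lt h g n x hl =>
    simp only [map_mul, FreeAlgebra.lift_ι_apply, starGen, op_mul_op, ρ_δ_lt _ _ hl]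
    simp
  | rho_delta_gt h g n x hl =>
    simp only [map_mul, FreeAlgebra.lift_ι_apply, starGen, op_mul_op, ρ_δ_gt _ _ hl]
  | rho_rho_gt h₁ h₂ n n' hl =>
    simp only [map_mul, FreeAlgebra.lift_ι_apply, starGen, op_mul_op]
    rw [ρ_ρ_lt h₂⁻¹ h₁⁻¹ hl]
    simp [mul_assoc]
  | rho_rho_lt h₁ h₂ n n' hl =>
    simp only [map_mul, FreeAlgebra.lift_ι_apply, starGen, op_mul_op]
    rw [ρ_ρ_gt h₂⁻¹ h₁⁻¹ hl]
    simp [mul_assoc]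

/-- The involution as a homomorphism to the conjugate opposite algebra. -/
def starHom : FLoc H →ₐ[ℂ] ConjOp (FLoc H) := lift starGen starGen_rel

instance : Star (FLoc H) := ⟨fun a => op.symm (starHom a)⟩

theorem star_def (a : FLoc H) : star a = op.symm (starHom a) := rfl

theorem star_δ (g : G) (x : ℤ) : star (δ g x : FLoc H) = δ g x := by
  rw [star_def, starHom, lift_δ, starGen, AddEquiv.symm_apply_apply]

theorem star_ρ (h : H) (n : ℤ) : star (ρ h n) = ρ h⁻¹ n := by
  rw [star_def, starHom, lift_ρ, starGen, AddEquiv.symm_apply_apply]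

theorem star_mul_aux (a b : FLoc H) : star (a * b) = star b * star a := by
  simp only [star_def, map_mul, symm_mul]

theorem star_add_aux (a b : FLoc H) : star (a + b) = star a + star b := by
  simp only [star_def, map_add]

theorem star_algebraMap_aux (c : ℂ) :
    star (algebraMap ℂ (FLoc H) c) = algebraMap ℂ (FLoc H) (star c) := by
  rw [star_def, AlgHom.commutes, symm_algebraMap]

instance : StarRing (FLoc H) where
  star_involutive a := by
    induction a using FLoc.induction with
    | algebraMap c => rw [star_algebraMap_aux, star_algebraMap_aux, star_star]
    | delta g x => rw [star_δ, star_δ]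
    | rho h n => rw [star_ρ, star_ρ, inv_inv]
    | mul a b ha hb => rw [star_mul_aux, star_mul_aux, ha, hb]
    | add a b ha hb => rw [star_add_aux, star_add_aux, ha, hb]
  star_mul := star_mul_aux
  star_add := star_add_aux

instance : StarModule ℂ (FLoc H) where
  star_smul c a := by
    rw [Algebra.smul_def, star_mul_aux, star_algebraMap_aux, ← Algebra.commutes,
      ← Algebra.smul_def]

/-! ### The C⋆-norm -/

/-- C⋆-seminorms on the local field algebra. -/
structure IsCStarSeminorm (p : Seminorm ℂ (FLoc H)) : Prop where
  mul_le : ∀ a b, p (a * b) ≤ p a * p b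
  star_mul_self : ∀ a, p (star a * a) = p a * p a

variable (H) in
/-- The type of all C⋆-seminorms on the local field algebra. -/
abbrev CStarSeminorm : Type u := {p : Seminorm ℂ (FLoc H) // IsCStarSeminorm p}

instance : Inhabited (CStarSeminorm H) := ⟨⟨0, ⟨by simp, by simp⟩⟩⟩

theorem IsCStarSeminorm.le_one_of_sq {t : ℝ} (h : t = t * t) : t ≤ 1 := by nlinarith

theorem IsCStarSeminorm.map_one_le {p : Seminorm ℂ (FLoc H)} (hp : IsCStarSeminorm p) :
    p 1 ≤ 1 := by
  have := hp.star_mul_self 1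
  rw [star_one, one_mul] at this
  exact le_one_of_sq this

theorem bddAbove_cstarSeminorm (a : FLoc H) :
    BddAbove (Set.range fun p : CStarSeminorm H => p.1 a) := by
  suffices h : ∃ C : ℝ, ∀ p : CStarSeminorm H, p.1 a ≤ C by
    obtain ⟨C, hC⟩ := h
    exact ⟨C, by rintro _ ⟨p, rfl⟩; exact hC p⟩
  induction a using FLoc.induction with
  | algebraMap c =>
    refine ⟨‖c‖, fun p => ?_⟩
    rw [Algebra.algebraMap_eq_smul_one, map_smul_eq_mul]
    exact mul_le_of_le_one_right (norm_nonneg _) p.2.map_one_le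
  | delta g x =>
    refine ⟨1, fun p => IsCStarSeminorm.le_one_of_sq ?_⟩
    have := p.2.star_mul_self (δ g x)
    rwa [star_δ, δ_mul_self] at this
  | rho h n =>
    refine ⟨1, fun p => ?_⟩
    have := p.2.star_mul_self (ρ h n)
    rw [star_ρ, ρ_mul, inv_mul_cancel, ρ_one] at this
    nlinarith [p.2.map_one_le, apply_nonneg p.1 (ρ h n)]
  | mul a b ha hb =>
    obtain ⟨C, hC⟩ := ha
    obtain ⟨D, hD⟩ := hb
    refine ⟨C * D, fun p => (p.2.mul_le a b).trans ?_⟩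
    exact mul_le_mul (hC p) (hD p) (apply_nonneg _ _) ((apply_nonneg p.1 a).trans (hC p))
  | add a b ha hb =>
    obtain ⟨C, hC⟩ := ha
    obtain ⟨D, hD⟩ := hb
    exact ⟨C + D, fun p => (map_add_le_add p.1 a b).trans (add_le_add (hC p) (hD p))⟩

/-- The largest C⋆-seminorm on the local field algebra. -/
def cnorm (a : FLoc H) : ℝ := ⨆ p : CStarSeminorm H, p.1 a

theorem le_cnorm (p : CStarSeminorm H) (a : FLoc H) : p.1 a ≤ cnorm a :=
  le_ciSup (bddAbove_cstarSeminorm a) p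

theorem cnorm_nonneg (a : FLoc H) : 0 ≤ cnorm a :=
  (apply_nonneg (default : CStarSeminorm H).1 a).trans (le_cnorm _ a)

theorem cnorm_le {a : FLoc H} {C : ℝ} (h : ∀ p : CStarSeminorm H, p.1 a ≤ C) : cnorm a ≤ C :=
  ciSup_le h

theorem cnorm_mul_le (a b : FLoc H) : cnorm (a * b) ≤ cnorm a * cnorm b :=
  cnorm_le fun p => (p.2.mul_le a b).trans <|
    mul_le_mul (le_cnorm p a) (le_cnorm p b) (apply_nonneg _ _) (cnorm_nonneg a)

theorem cnorm_mul_self_le (a : FLoc H) : cnorm a * cnorm a ≤ cnorm (star a * a) := by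
  have h : cnorm a ≤ √(cnorm (star a * a)) := cnorm_le fun p => by
    refine Real.le_sqrt_of_sq_le ?_
    rw [sq, ← p.2.star_mul_self]
    exact le_cnorm p _
  calc _ ≤ √(cnorm (star a * a)) * √(cnorm (star a * a)) :=
        mul_le_mul h h (cnorm_nonneg a) (Real.sqrt_nonneg _)
    _ = _ := Real.mul_self_sqrt (cnorm_nonneg _)

theorem cnorm_le_star (a : FLoc H) : cnorm a ≤ cnorm (star a) := by
  rcases (cnorm_nonneg a).eq_or_lt with h | h
  · rw [← h]; exact cnorm_nonneg _
  · exact le_of_mul_le_mul_right ((cnorm_mul_self_le a).trans (cnorm_mul_le _ _)) h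

theorem cnorm_star (a : FLoc H) : cnorm (star a) = cnorm a :=
  le_antisymm (by simpa using cnorm_le_star (star a)) (cnorm_le_star a)

/-- `cnorm` as a ring seminorm. -/
def cnormSeminorm (H : Subgroup G) : RingSeminorm (FLoc H) where
  toFun := cnorm
  map_zero' := le_antisymm (cnorm_le fun p => by simp) (cnorm_nonneg _)
  add_le' a b := cnorm_le fun p =>
    (map_add_le_add p.1 a b).trans (add_le_add (le_cnorm p a) (le_cnorm p b))
  neg' a := by simp only [cnorm, map_neg_eq_map]
  mul_le' := cnorm_mul_le

instance : SeminormedRing (FLoc H) := (cnormSeminorm H).toSeminormedRing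

theorem norm_def (a : FLoc H) : ‖a‖ = cnorm a := rfl

instance : NormedAlgebra ℂ (FLoc H) where
  norm_smul_le c a := cnorm_le fun p => by
    rw [map_smul_eq_mul]
    exact mul_le_mul_of_nonneg_left (le_cnorm p a) (norm_nonneg c)

instance : NormedStarGroup (FLoc H) := ⟨fun a => (cnorm_star a).le⟩

theorem norm_map_le {B : Type*} [CStarAlgebra B] (φ : FLoc H →⋆ₐ[ℂ] B) (a : FLoc H) :
    ‖φ a‖ ≤ ‖a‖ := by
  let p : Seminorm ℂ (FLoc H) := (normSeminorm ℂ B).comp φ.toAlgHom.toLinearMap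
  have hp : ∀ b, p b = ‖φ b‖ := fun _ => rfl
  have hC : IsCStarSeminorm p :=
    ⟨fun b c => by simpa only [hp, map_mul] using norm_mul_le _ _,
     fun b => by simpa only [hp, map_mul, map_star] using CStarRing.norm_star_mul_self⟩
  exact le_cnorm ⟨p, hC⟩ a

end FLoc

end LocalField

/-! ## The field algebra -/

section FieldAlgebra

open UniformSpace

variable {G : Type u} [Group G] [Fintype G]

/-- The field algebra determined by `H`: the completion of the local field algebra with respect to
its largest C⋆-seminorm. The local field algebra is an increasing union of finite-dimensional
C⋆-algebras (those generated by the fields in a finite interval), on each of which the C⋆-norm is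
unique, so this completion is their C⋆-inductive limit. -/
def FieldAlgebra (H : Subgroup G) : Type u := Completion (FLoc H)

namespace FieldAlgebra

variable {H : Subgroup G}

instance : NormedRing (FieldAlgebra H) := inferInstanceAs (NormedRing (Completion (FLoc H)))
instance : CompleteSpace (FieldAlgebra H) := inferInstanceAs (CompleteSpace (Completion (FLoc H)))
instance : Algebra ℂ (FieldAlgebra H) := inferInstanceAs (Algebra ℂ (Completion (FLoc H)))

/-- The canonical map from the local field algebra to the field algebra. -/
def of : FLoc H →ₐ[ℂ] FieldAlgebra H where
  __ := (Completion.coeRingHom : FLoc H →+* Completion (FLoc H))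
  commutes' _ := rfl

theorem norm_of (a : FLoc H) : ‖of a‖ = ‖a‖ := Completion.norm_coe a

theorem continuous_of : Continuous (of : FLoc H → FieldAlgebra H) := Completion.continuous_coe _

theorem denseRange_of : DenseRange (of : FLoc H → FieldAlgebra H) := Completion.denseRange_coe

@[elab_as_elim]
theorem induction {C : FieldAlgebra H → Prop} (a : FieldAlgebra H) (hc : IsClosed {a | C a})
    (h : ∀ a, C (of a)) : C a :=
  Completion.induction_on a hc h

@[elab_as_elim]
theorem induction₂ {C : FieldAlgebra H → FieldAlgebra H → Prop} (a b : FieldAlgebra H)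
    (hc : IsClosed {x : FieldAlgebra H × FieldAlgebra H | C x.1 x.2})
    (h : ∀ a b, C (of a) (of b)) : C a b :=
  Completion.induction_on₂ a b hc h

instance : NormedAlgebra ℂ (FieldAlgebra H) where
  norm_smul_le c a := by
    induction a using FieldAlgebra.induction with
    | hc =>
      simp only [Algebra.smul_def]
      exact isClosed_le (by fun_prop) (by fun_prop)
    | h a =>
      rw [← map_smul, norm_of, norm_of]
      exact norm_smul_le c a

instance : Star (FieldAlgebra H) := ⟨Completion.map (star : FLoc H → FLoc H)⟩

theorem star_of (a : FLoc H) : star (of a) = of (star a) :=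
  Completion.map_coe (f := (star : FLoc H → FLoc H))
    (starNormedAddGroupHom (E := FLoc H)).uniformContinuous a

theorem continuous_star_aux : Continuous (star : FieldAlgebra H → FieldAlgebra H) :=
  Completion.continuous_map

instance : StarRing (FieldAlgebra H) where
  star_involutive a := by
    have h := continuous_star_aux (H := H)
    induction a using FieldAlgebra.induction with
    | hc => exact isClosed_eq (by fun_prop) (by fun_prop)
    | h a => rw [star_of, star_of, star_star]
  star_mul a b := by
    have h := continuous_star_aux (H := H)
    induction a, b using FieldAlgebra.induction₂ with
    | hc => exact isClosed_eq (by fun_prop) (by fun_prop)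
    | h a b => rw [← map_mul, star_of, star_of, star_of, star_mul, map_mul]
  star_add a b := by
    have h := continuous_star_aux (H := H)
    induction a, b using FieldAlgebra.induction₂ with
    | hc => exact isClosed_eq (by fun_prop) (by fun_prop)
    | h a b => rw [← map_add, star_of, star_of, star_of, star_add, map_add]

/-- The field algebra is a unital C⋆-algebra. -/
instance : CStarAlgebra (FieldAlgebra H) where
  norm_mul_self_le a := by
    have h := continuous_star_aux (H := H)
    induction a using FieldAlgebra.induction with
    | hc => exact isClosed_le (by fun_prop) (by fun_prop)
    | h a =>
      rw [star_of, ← map_mul, norm_of, norm_of]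
      exact FLoc.cnorm_mul_self_le a
  star_smul c a := by
    have h := continuous_star_aux (H := H)
    induction a using FieldAlgebra.induction with
    | hc => exact isClosed_eq (h.comp (continuous_const_smul c)) (continuous_const_smul _ |>.comp h)
    | h a => rw [← map_smul, star_of, star_of, star_smul, map_smul]

/-- The field `δ_g(x)`. -/
def δ (g : G) (x : ℤ) : FieldAlgebra H := of (FLoc.δ g x)

/-- The field `ρ_h(n + 1/2)`. -/
def ρ (h : H) (n : ℤ) : FieldAlgebra H := of (FLoc.ρ h n)

end FieldAlgebra

end FieldAlgebra

/-! ## The Hopf algebra `D(H;G)` and its action -/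

section Action

variable {G : Type u} [Group G]

/-- The crossed product `D(H;G)` of the functions on `H` and the group algebra of `G`, through its
linear basis of pairs `(h, g)` (the function `δ_h` times the group element `g`); the structure maps
`mul`, `counit` and `comul` follow. -/
def D (H : Subgroup G) : Type u := (H × G) →₀ ℂ

namespace D

variable {H : Subgroup G}

instance : AddCommGroup (D H) := inferInstanceAs (AddCommGroup ((H × G) →₀ ℂ))
instance : Module ℂ (D H) := inferInstanceAs (Module ℂ ((H × G) →₀ ℂ))

variable (H) in
/-- The linear basis of `D(H;G)` formed by the elements `(h, g)`. -/
def basis : Module.Basis (H × G) ℂ (D H) := Finsupp.basisSingleOne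

open Classical in
/-- The multiplication `(h₁, g₁)(h₂, g₂) = δ_{h₁g₁, g₁h₂} (h₁, g₁g₂)` of `D(H;G)`. -/
def mul : D H →ₗ[ℂ] D H →ₗ[ℂ] D H :=
  (basis H).constr ℂ fun a => (basis H).constr ℂ fun b =>
    if (a.1 : G) * a.2 = a.2 * (b.1 : G) then basis H (a.1, a.2 * b.2) else 0

open Classical in
/-- The counit `ε(h, g) = δ_{h, e}` of `D(H;G)`. -/
def counit : D H →ₗ[ℂ] ℂ := (basis H).constr ℂ fun a => if a.1 = 1 then 1 else 0

open scoped TensorProduct in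
/-- The coproduct `Δ(h, g) = ∑_{t ∈ H} (t, g) ⊗ (t⁻¹h, g)` of `D(H;G)`. -/
def comul : D H →ₗ[ℂ] D H ⊗[ℂ] D H :=
  (basis H).constr ℂ fun a => ∑ᶠ t : H, basis H (t, a.2) ⊗ₜ[ℂ] basis H (t⁻¹ * a.1, a.2)

@[elab_as_elim]
theorem induction {C : D H → Prop} (a : D H) (basis : ∀ h g, C (basis H (h, g)))
    (add : ∀ a b, C a → C b → C (a + b)) (smul : ∀ (c : ℂ) a, C a → C (c • a)) : C a := by
  have h0 : C 0 := by simpa using smul 0 _ (basis 1 1)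
  refine Submodule.span_induction (p := fun a _ => C a) ?_ h0 (fun a b _ _ => add a b)
    (fun c a _ => smul c a) ((D.basis H).mem_span a)
  rintro _ ⟨⟨h, g⟩, rfl⟩
  exact basis h g

open Classical in
theorem mul_basis (h₁ h₂ : H) (g₁ g₂ : G) : mul (basis H (h₁, g₁)) (basis H (h₂, g₂)) =
    if (h₁ : G) * g₁ = g₁ * (h₂ : G) then basis H (h₁, g₁ * g₂) else 0 := by
  rw [mul, Module.Basis.constr_basis, Module.Basis.constr_basis]

open Classical in
theorem counit_basis (h : H) (g : G) : counit (basis H (h, g)) = if h = 1 then 1 else 0 := by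
  rw [counit, Module.Basis.constr_basis]

theorem comul_basis [Fintype H] (h : H) (g : G) : comul (basis H (h, g)) =
    ∑ t : H, basis H (t, g) ⊗ₜ[ℂ] basis H (t⁻¹ * h, g) := by
  rw [comul, Module.Basis.constr_basis, finsum_eq_sum_of_fintype]

end D

variable [Fintype G] {H : Subgroup G} [H.Normal]

/-- For `g ∈ G`, the images of the generators under `a ↦ ∑_{h ∈ H} ((h, g) a) h`, where the
coefficients `(h, g) a` of the group algebra element on the right are those of the action on
generators: `(h, g) δ_f(x) = δ_{h,e} δ_{gf}(x)` and `(h, g) ρ_t(l) = δ_{h,gtg⁻¹} ρ_h(l)`. -/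
def actGen (g : G) : Gen H → MonoidAlgebra (FLoc H) H
  | .delta f x => .single 1 (FLoc.δ (g * f) x)
  | .rho t n => .single (MulAut.conjNormal g t) (FLoc.ρ (MulAut.conjNormal g t) n)

theorem actGen_rel (g : G) ⦃a b : FreeAlgebra ℂ (Gen H)⦄ (hab : Rel H a b) :
    FreeAlgebra.lift ℂ (actGen (H := H) g) a = FreeAlgebra.lift ℂ (actGen (H := H) g) b := by
  cases hab with
  | sum_delta x =>
    simp only [map_sum, FreeAlgebra.lift_ι_apply, map_one, actGen]
    have h := Equiv.sum_comp (Equiv.mulLeft g) fun k => (FLoc.δ k x : FLoc H)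
    rw [FLoc.sum_δ] at h
    rw [MonoidAlgebra.one_def, ← h]
    exact (map_sum (MonoidAlgebra.singleAddHom (R := FLoc H) (1 : H))
      (fun k => FLoc.δ (g * k) x) Finset.univ).symm
  | rho_one n =>
    simp [actGen, FLoc.ρ_one, MonoidAlgebra.one_def]
  | delta_mul_self f x =>
    simp [actGen, FLoc.δ_mul_self]
  | delta_mul_ne g₁ g₂ x hg =>
    simp [actGen, FLoc.δ_mul_ne x (fun h => hg (mul_left_cancel h) : g * g₁ ≠ g * g₂)]
  | rho_mul h₁ h₂ n =>
    simp [actGen, FLoc.ρ_mul]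
  | delta_comm g₁ g₂ x x' =>
    simp [actGen, FLoc.δ_comm (g * g₁)]
  | rho_delta_lt h f n x hl =>
    simp [actGen, FLoc.ρ_δ_lt _ _ hl, mul_assoc]
  | rho_delta_gt h f n x hl =>
    simp [actGen, FLoc.ρ_δ_gt _ _ hl]
  | rho_rho_gt h₁ h₂ n n' hl =>
    simp [actGen, FLoc.ρ_ρ_gt _ _ hl, mul_assoc]
  | rho_rho_lt h₁ h₂ n n' hl =>
    simp [actGen, FLoc.ρ_ρ_lt _ _ hl, mul_assoc]

/-- The homomorphism `a ↦ ∑_{h ∈ H} ((h, g) a) h`. Its multiplicativity says that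
`(h, g)(ab) = ∑_{t ∈ H} (t, g)(a) (t⁻¹h, g)(b)`. -/
def actHom (g : G) : FLoc H →ₐ[ℂ] MonoidAlgebra (FLoc H) H :=
  FLoc.lift (actGen (H := H) g) (actGen_rel g)

/-- The action of the basis element `(h, g)` of `D(H;G)` on the local field algebra. -/
def actLoc (h : H) (g : G) : FLoc H →ₗ[ℂ] FLoc H where
  toFun a := (actHom g a).coeff h
  map_add' a b := by simp
  map_smul' c a := by simp

open Classical in
theorem actLoc_δ (h : H) (g f : G) (x : ℤ) :
    actLoc h g (FLoc.δ f x) = if h = 1 then FLoc.δ (g * f) x else 0 := by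
  change (actHom g (FLoc.δ f x)).coeff h = _
  rw [actHom, FLoc.lift_δ, actGen, MonoidAlgebra.coeff_single, Finsupp.single_apply]
  simp only [eq_comm]

open Classical in
theorem actLoc_ρ (h : H) (g : G) (t : H) (n : ℤ) :
    actLoc h g (FLoc.ρ t n) = if (h : G) = g * t * g⁻¹ then FLoc.ρ h n else 0 := by
  change (actHom g (FLoc.ρ t n)).coeff h = _
  rw [actHom, FLoc.lift_ρ, actGen, MonoidAlgebra.coeff_single, Finsupp.single_apply, ← MulAut.conjNormal_apply,
    ← Subtype.ext_iff]
  split_ifs with h1 h2 h2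
  · rw [h1]
  · exact absurd h1.symm h2
  · exact absurd h2.symm h1
  · rfl

open Classical in
theorem actLoc_algebraMap (h : H) (g : G) (c : ℂ) :
    actLoc h g (algebraMap ℂ (FLoc H) c) = if h = 1 then algebraMap ℂ (FLoc H) c else 0 := by
  change (actHom g _).coeff h = _
  rw [AlgHom.commutes, Algebra.algebraMap_eq_smul_one, MonoidAlgebra.coeff_smul_apply,
    MonoidAlgebra.one_def, MonoidAlgebra.coeff_single, Finsupp.single_apply]
  simp only [eq_comm (a := (1 : H))]
  split_ifs
  · rw [Algebra.algebraMap_eq_smul_one]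
  · simp

theorem actLoc_mul [Fintype H] (h : H) (g : G) (a b : FLoc H) :
    actLoc h g (a * b) = ∑ t, actLoc t g a * actLoc (t⁻¹ * h) g b := by
  change (actHom g (a * b)).coeff h = _
  rw [map_mul, MonoidAlgebra.coeff_mul_apply_left, Finsupp.sum_fintype _ _ (by simp)]
  rfl

theorem actLoc_star (h : H) (g : G) (a : FLoc H) :
    actLoc h g (star a) = star (actLoc h⁻¹ g a) := by
  classical
  let _ : Fintype H := Fintype.ofFinite H
  induction a using FLoc.induction generalizing h with
  | algebraMap c =>
    rw [FLoc.star_algebraMap_aux, actLoc_algebraMap, actLoc_algebraMap]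
    simp only [inv_eq_one]
    split_ifs
    · rw [FLoc.star_algebraMap_aux]
    · simp
  | delta f x =>
    rw [FLoc.star_δ, actLoc_δ, actLoc_δ]
    simp only [inv_eq_one]
    split_ifs
    · rw [FLoc.star_δ]
    · simp
  | rho t n =>
    have : ((h : G) = g * (t⁻¹ : H) * g⁻¹) ↔ ((h⁻¹ : H) : G) = g * t * g⁻¹ := by
      rw [← inv_inj]
      simp [mul_assoc]
    rw [FLoc.star_ρ, actLoc_ρ, actLoc_ρ]
    simp only [this]
    split_ifs
    · rw [FLoc.star_ρ, inv_inv]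
    · simp
  | mul a b ha hb =>
    rw [star_mul, actLoc_mul, actLoc_mul, star_sum]
    simp only [ha, hb, star_mul]
    refine Fintype.sum_equiv ((Equiv.mulLeft h⁻¹).trans (Equiv.refl H)) _ _ fun t => ?_
    simp [mul_assoc]
  | add a b ha hb => rw [star_add, map_add, map_add, star_add, ha, hb]

open Classical in
theorem actLoc_actLoc (h₁ h₂ : H) (g₁ g₂ : G) (a : FLoc H) :
    actLoc h₁ g₁ (actLoc h₂ g₂ a) =
      if (h₁ : G) * g₁ = g₁ * (h₂ : G) then actLoc h₁ (g₁ * g₂) a else 0 := by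
  let _ : Fintype H := Fintype.ofFinite H
  have key : ∀ (h₁ h₂ : H), (h₁ : G) * g₁ = g₁ * (h₂ : G) ↔ h₂ = MulAut.conjNormal g₁⁻¹ h₁ := by
    intro h₁ h₂
    rw [Subtype.ext_iff, MulAut.conjNormal_apply, inv_inv, mul_assoc, eq_inv_mul_iff_mul_eq,
      eq_comm]
  simp only [key]
  induction a using FLoc.induction generalizing h₁ h₂ with
  | algebraMap c =>
    simp only [actLoc_algebraMap]
    by_cases h : h₁ = 1
    · subst h
      by_cases h' : h₂ = 1 <;> simp [h', actLoc_algebraMap]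
    · by_cases h' : h₂ = 1
      · subst h'
        simp [h, actLoc_algebraMap]
      · simp [h, h']
  | delta f x =>
    simp only [actLoc_δ]
    by_cases h : h₁ = 1
    · subst h
      by_cases h' : h₂ = 1 <;> simp [h', actLoc_δ, mul_assoc]
    · by_cases h' : h₂ = 1
      · subst h'
        simp [h, actLoc_δ]
      · simp [h, h']
  | rho t n =>
    simp only [actLoc_ρ]
    by_cases h : h₂ = MulAut.conjNormal g₁⁻¹ h₁
    · subst h
      have e : ((MulAut.conjNormal g₁⁻¹ h₁ : H) : G) = g₂ * t * g₂⁻¹ ↔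
          (h₁ : G) = g₁ * g₂ * t * (g₁ * g₂)⁻¹ := by
        rw [MulAut.conjNormal_apply]
        constructor <;> intro h
        · rw [mul_inv_rev, ← mul_assoc, mul_assoc g₁, mul_assoc g₁, ← h]; group
        · rw [h]; group
      simp only [e, if_true]
      split_ifs with h1
      · rw [actLoc_ρ, if_pos]
        rw [MulAut.conjNormal_apply]; group
      · simp
    · rw [if_neg h]
      split_ifs
      · rw [actLoc_ρ, if_neg]
        intro h'
        apply h
        rw [Subtype.ext_iff, MulAut.conjNormal_apply, h']; group
      · simp
  | mul a b ha hb =>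
    simp only [actLoc_mul, map_sum, ha, hb]
    rw [Finset.sum_comm]
    have : ∀ s t : H, (if t = MulAut.conjNormal g₁⁻¹ s then actLoc s (g₁ * g₂) a else 0) *
        (if t⁻¹ * h₂ = MulAut.conjNormal g₁⁻¹ (s⁻¹ * h₁) then actLoc (s⁻¹ * h₁) (g₁ * g₂) b else 0) =
        if t = MulAut.conjNormal g₁⁻¹ s then
          (if h₂ = MulAut.conjNormal g₁⁻¹ h₁ then
            actLoc s (g₁ * g₂) a * actLoc (s⁻¹ * h₁) (g₁ * g₂) b else 0) else 0 := by
      intro s t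
      by_cases h : t = MulAut.conjNormal g₁⁻¹ s
      · subst h
        simp
      · rw [if_neg h, if_neg h, zero_mul]
    simp only [this, Finset.sum_ite_eq', Finset.mem_univ, if_true]
    split_ifs <;> simp
  | add a b ha hb =>
    rw [map_add, map_add, ha, hb, map_add]
    split_ifs <;> simp

theorem norm_actLoc_le (h : H) (g : G) (a : FLoc H) : ‖actLoc h g a‖ ≤ ‖a‖ := by
  classical
  let _ : Fintype H := Fintype.ofFinite H
  let _ : PartialOrder (FieldAlgebra H) := CStarAlgebra.spectralOrder _
  have : StarOrderedRing (FieldAlgebra H) := CStarAlgebra.spectralOrderedRing _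
  obtain ⟨M, hM⟩ : ∃ M : FLoc H → CStarMatrix H H (FieldAlgebra H),
      ∀ a s t, M a s t = FieldAlgebra.of (actLoc (s * t⁻¹) g a) :=
    ⟨fun a => CStarMatrix.ofMatrix
      (Matrix.of fun s t => FieldAlgebra.of (actLoc (s * t⁻¹) g a)), fun _ _ _ => rfl⟩
  let ψ : FLoc H →⋆ₐ[ℂ] CStarMatrix H H (FieldAlgebra H) :=
    { toFun := M
      map_one' := by
        ext s t
        rw [hM, CStarMatrix.one_apply, ← map_one (algebraMap ℂ (FLoc H)), actLoc_algebraMap]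
        simp only [mul_inv_eq_one]
        split_ifs <;> simp
      map_mul' a b := by
        ext s t
        rw [CStarMatrix.mul_apply, hM, actLoc_mul, map_sum]
        refine Fintype.sum_equiv ((Equiv.inv H).trans (Equiv.mulRight s)) _ _ fun r => ?_
        simp [hM, mul_assoc]
      map_zero' := by ext s t; simp [hM]
      map_add' a b := by ext s t; simp [hM]
      commutes' c := by
        ext s t
        rw [hM, CStarMatrix.algebraMap_apply, actLoc_algebraMap]
        simp only [mul_inv_eq_one]
        split_ifs <;> simp
      map_star' a := by
        ext s t
        rw [CStarMatrix.star_apply, hM, hM, actLoc_star, FieldAlgebra.star_of]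
        simp }
  have h1 : ‖ψ a h 1‖ ≤ ‖a‖ := CStarMatrix.norm_entry_le_norm.trans (FLoc.norm_map_le ψ a)
  have h2 : ψ a h 1 = FieldAlgebra.of (actLoc (h * 1⁻¹) g a) := hM a h 1
  rwa [h2, FieldAlgebra.norm_of, inv_one, mul_one] at h1

/-- The action of the basis element `(h, g)` of `D(H;G)` on the field algebra, the continuous
extension of the action on the local field algebra. -/
def act (h : H) (g : G) : FieldAlgebra H →L[ℂ] FieldAlgebra H :=
  (FieldAlgebra.of.toLinearMap ∘ₗ actLoc h g).extendOfNorm FieldAlgebra.of.toLinearMap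

theorem act_of (h : H) (g : G) (a : FLoc H) :
    act h g (FieldAlgebra.of a) = FieldAlgebra.of (actLoc h g a) :=
  LinearMap.extendOfNorm_eq (f := FieldAlgebra.of.toLinearMap ∘ₗ actLoc h g)
    (e := FieldAlgebra.of.toLinearMap) FieldAlgebra.denseRange_of
    ⟨1, fun a => by
      simpa [FieldAlgebra.norm_of] using norm_actLoc_le h g a⟩ a

/-- The action `γ` of `D(H;G)` on the field algebra. -/
def γ : D H →ₗ[ℂ] FieldAlgebra H →L[ℂ] FieldAlgebra H :=
  (D.basis H).constr ℂ fun a => act a.1 a.2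

theorem γ_basis (h : H) (g : G) : γ (D.basis H (h, g)) = act h g :=
  (D.basis H).constr_basis ℂ _ _

open Classical in
theorem γ_basis_δ (h : H) (g f : G) (x : ℤ) :
    γ (D.basis H (h, g)) (FieldAlgebra.δ f x) =
      if h = 1 then FieldAlgebra.δ (g * f) x else 0 := by
  rw [γ_basis, FieldAlgebra.δ, act_of, actLoc_δ]
  split_ifs
  · rfl
  · simp

open Classical in
theorem γ_basis_ρ (h : H) (g : G) (t : H) (n : ℤ) :
    γ (D.basis H (h, g)) (FieldAlgebra.ρ t n) =
      if (h : G) = g * t * g⁻¹ then FieldAlgebra.ρ h n else 0 := by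
  rw [γ_basis, FieldAlgebra.ρ, act_of, actLoc_ρ]
  split_ifs
  · rfl
  · simp

theorem γ_one (a : D H) : γ a (1 : FieldAlgebra H) = D.counit a • (1 : FieldAlgebra H) := by
  classical
  induction a using D.induction with
  | add a b ha hb => rw [map_add, map_add, add_smul, ← ha, ← hb]; rfl
  | smul c a ha => rw [map_smul, map_smul, smul_assoc, ← ha]; rfl
  | basis h g =>
    rw [γ_basis, D.counit_basis, ← map_one FieldAlgebra.of, act_of,
      ← map_one (algebraMap ℂ (FLoc H)), actLoc_algebraMap]
    split_ifs <;> simp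

/-- The field algebra is a `D(H;G)`-module. -/
theorem γ_mul (a b : D H) (F : FieldAlgebra H) : γ (D.mul a b) F = γ a (γ b F) := by
  classical
  induction a using D.induction with
  | add a a' ha hb => simp [ha, hb]
  | smul c a ha => simp [ha]
  | basis h₁ g₁ =>
    induction b using D.induction with
    | add a a' ha hb => simp [ha, hb]
    | smul c a ha => simp [ha]
    | basis h₂ g₂ =>
      rw [γ_basis, γ_basis, D.mul_basis]
      induction F using FieldAlgebra.induction with
      | hc => exact isClosed_eq (by fun_prop) (by fun_prop)
      | h a =>
        rw [act_of, act_of, actLoc_actLoc]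
        split_ifs
        · rw [γ_basis, act_of]
        · simp

/-- The field algebra is a `D(H;G)`-module algebra: `a(FF') = ∑ a₍₁₎(F) a₍₂₎(F')`. -/
theorem γ_apply_mul (a : D H) (F F' : FieldAlgebra H) :
    γ a (F * F') = TensorProduct.lift
      ((LinearMap.mul ℂ (FieldAlgebra H)).compl₁₂
        ((ContinuousLinearMap.apply ℂ (FieldAlgebra H) F).toLinearMap ∘ₗ γ)
        ((ContinuousLinearMap.apply ℂ (FieldAlgebra H) F').toLinearMap ∘ₗ γ)) (D.comul a) := by
  classical
  let _ : Fintype H := Fintype.ofFinite H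
  induction a using D.induction with
  | add a b ha hb => rw [map_add, map_add, map_add, ← ha, ← hb]; rfl
  | smul c a ha => rw [map_smul, map_smul, map_smul, ← ha]; rfl
  | basis h g =>
    rw [D.comul_basis, map_sum]
    simp only [TensorProduct.lift.tmul, LinearMap.compl₁₂_apply, LinearMap.comp_apply,
      ContinuousLinearMap.coe_coe, ContinuousLinearMap.apply_apply, LinearMap.mul_apply', γ_basis]
    induction F, F' using FieldAlgebra.induction₂ with
    | hc => exact isClosed_eq (by fun_prop) (by fun_prop)
    | h a b => simp only [← map_mul, act_of, actLoc_mul, map_sum]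

end Action

/-! ## Observables -/

section Observables

variable {G : Type u} [Group G] [Fintype G] (H : Subgroup G) [H.Normal]

/-- The observable algebra `𝒜_{(H,G)}`: the `D(H;G)`-invariant elements of the field algebra. -/
def observables : Set (FieldAlgebra H) := {F | ∀ a : D H, γ a F = D.counit a • F}

variable {H}

/-- `v_h(x) = ∑_{k ∈ G} ρ_{kh⁻¹k⁻¹}(x - 1/2) δ_k(x) ρ_{khk⁻¹}(x + 1/2)`. -/
def v (h : H) (x : ℤ) : FieldAlgebra H :=
  ∑ k : G, FieldAlgebra.ρ (MulAut.conjNormal k h⁻¹) (x - 1) * FieldAlgebra.δ k x *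
    FieldAlgebra.ρ (MulAut.conjNormal k h) x

/-- `w_g(l) = ∑_{k ∈ G} δ_k(l - 1/2) δ_{kg}(l + 1/2)` for `l = n + 1/2`. -/
def w (g : G) (n : ℤ) : FieldAlgebra H :=
  ∑ k : G, FieldAlgebra.δ k n * FieldAlgebra.δ (k * g) (n + 1)

end Observables

end GSpin

end

namespace GSpin

universe u

section

variable {G : Type u} [Group G] [Fintype G] {H : Subgroup G}

/-! ### Field relations in terms of integer indices. -/

namespace FLoc

/-! The element `∑ g, (1, g)` of `D(H;G)` acts as an averaging operator: it multiplies every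
observable by `|G|`, and it is linear over the invariant elements. By continuity and density it is
enough to show that it sends the local field algebra into the algebra generated by the `v_h(x)` and
`w_g(l)`. Conversely, these generators are invariant, the local invariants form a `⋆`-algebra, and
invariance is a closed condition.

To compute the average of a local element, fix a site `n` to the left of its support. The
observables express each field through its left neighbours: `δ_k(n+1) = ∑_j δ_j(n) w_{j⁻¹k}(n+1/2)`
(`δ_succ_eq_sum`) and `ρ_t(x+1/2) = ρ_t(x-1/2) ∑_j δ_j(x) v_{j⁻¹tj}(x)` (`ρ_eq_sum`). All fields
thus reduce to observables to the right of `n` and the base fields `δ_k(n)`, `ρ_t(n-1/2)`. Base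
fields can be moved to the right of these observables (`commute_ρ_of_mem_obsRight`,
`exists_δ_mul_eq_sum`), so every local element is a combination of terms `b δ_k(n) ρ_t(n-1/2)` with
`b` generated by observables (`exists_mem_rightSpan`).

Since `b` is invariant, averaging only affects the base fields. The result is `b` times `∑_g
δ_{gk}(n) = 1` if `t = 1`, and zero otherwise (`exists_sum_actLoc_mem_obsRight`). -/

theorem ρ_δ_of_lt (h : H) (g : G) {n x : ℤ} (hl : n < x) :
    ρ h n * δ g x = δ (h * g) x * ρ h n := by
  refine ρ_δ_lt h g ?_
  have : (n : ℚ) + 1 ≤ x := by exact_mod_cast hl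
  linarith

theorem ρ_δ_of_le (h : H) (g : G) {n x : ℤ} (hl : x ≤ n) :
    ρ h n * δ g x = δ g x * ρ h n := by
  refine ρ_δ_gt h g ?_
  have : (x : ℚ) ≤ n := by exact_mod_cast hl
  linarith

/-- At equal positions this is just multiplication in `H`. Including that case lets `commute_ρ_vLoc`
treat the neighbouring position `n = x - 1` along with the others. -/
theorem ρ_ρ_of_le (h₁ h₂ : H) {n n' : ℤ} (hl : n ≤ n') :
    ρ h₁ n * ρ h₂ n' = ρ (h₁ * h₂ * h₁⁻¹) n' * ρ h₁ n := by
  rcases hl.eq_or_lt with rfl | hl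
  · rw [ρ_mul, ρ_mul, inv_mul_cancel_right]
  · refine ρ_ρ_lt h₁ h₂ ?_
    have : (n : ℚ) < n' := by exact_mod_cast hl
    linarith

open Classical in
theorem δ_mul_δ (g₁ g₂ : G) (x : ℤ) :
    (δ g₁ x * δ g₂ x : FLoc H) = if g₁ = g₂ then δ g₁ x else 0 := by
  split_ifs with h
  · rw [h, δ_mul_self]
  · exact δ_mul_ne x h

end FLoc

variable (H) in
/-- The canonical map from the local field algebra to the field algebra as a `⋆`-homomorphism. -/
noncomputable def FieldAlgebra.ofStar : FLoc H →⋆ₐ[ℂ] FieldAlgebra H where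
  __ := FieldAlgebra.of
  map_star' a := (FieldAlgebra.star_of a).symm

/-! ### The local observables `w_g`. -/

/-- `w_g(n + 1/2)` in the local field algebra. -/
noncomputable def wLoc (g : G) (n : ℤ) : FLoc H := ∑ k : G, FLoc.δ k n * FLoc.δ (k * g) (n + 1)

theorem of_wLoc (g : G) (n : ℤ) : FieldAlgebra.of (wLoc g n : FLoc H) = w g n := by
  simp [wLoc, w, FieldAlgebra.δ]

open Classical in
theorem δ_mul_wLoc (k g : G) (n : ℤ) :
    (FLoc.δ k n * wLoc g n : FLoc H) = FLoc.δ k n * FLoc.δ (k * g) (n + 1) := by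
  simp [wLoc, Finset.mul_sum, ← mul_assoc, FLoc.δ_mul_δ, ite_mul]

/-- Insert `1 = ∑_j δ_j(n)`: once the value at `n` is known to be `j`, the observable with index
`j⁻¹k` forces the value `k` at `n + 1`. -/
theorem δ_succ_eq_sum (k : G) (n : ℤ) :
    (FLoc.δ k (n + 1) : FLoc H) = ∑ j, FLoc.δ j n * wLoc (j⁻¹ * k) n := by
  simp only [δ_mul_wLoc, mul_inv_cancel_left]
  rw [← Finset.sum_mul, FLoc.sum_δ, one_mul]

theorem commute_δ_wLoc (k g : G) (x n : ℤ) : Commute (FLoc.δ k x : FLoc H) (wLoc g n) := by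
  refine Commute.sum_right _ _ _ fun j _ => Commute.mul_right ?_ ?_ <;> exact FLoc.δ_comm _ _ _ _

/-- Passing `ρ_t` translates both `δ` factors by `t` on the left, which only permutes the summands,
since `w` records the right quotient `g` alone. -/
theorem commute_ρ_wLoc (t : H) (g : G) {m n : ℤ} (h : m < n) :
    Commute (FLoc.ρ t m) (wLoc g n) := by
  rw [Commute, SemiconjBy, wLoc, Finset.mul_sum, Finset.sum_mul]
  refine Fintype.sum_equiv (Equiv.mulLeft (t : G)) _ _ fun k => ?_
  rw [← mul_assoc, FLoc.ρ_δ_of_lt _ _ h, mul_assoc, FLoc.ρ_δ_of_lt _ _ (by omega)]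
  simp [mul_assoc]

/-! ### The local observables `v_h`. -/

variable [H.Normal]

/-- `v_h(x)` in the local field algebra. -/
noncomputable def vLoc (h : H) (x : ℤ) : FLoc H :=
  ∑ k : G, FLoc.ρ (MulAut.conjNormal k h⁻¹) (x - 1) * FLoc.δ k x *
    FLoc.ρ (MulAut.conjNormal k h) x

theorem of_vLoc (h : H) (x : ℤ) : FieldAlgebra.of (vLoc h x) = v h x := by
  simp [vLoc, v, FieldAlgebra.δ, FieldAlgebra.ρ]

theorem vLoc_eq (h : H) (x : ℤ) : vLoc h x =
    ∑ k : G, FLoc.δ (k * (h : G)⁻¹) x *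
      (FLoc.ρ (MulAut.conjNormal k h⁻¹) (x - 1) * FLoc.ρ (MulAut.conjNormal k h) x) := by
  refine Finset.sum_congr rfl fun k _ => ?_
  rw [FLoc.ρ_δ_of_lt _ _ (by omega), mul_assoc]
  congr 2
  simp [mul_assoc]

theorem conjNormal_mul_self {G : Type*} [Group G] {H : Subgroup G} [H.Normal] (j : G) (h : H) :
    MulAut.conjNormal (j * h) h = MulAut.conjNormal j h := by
  ext; simp [mul_assoc]

/-- Only the summand `k = jh` survives, and conjugating `h` by `jh` is the same as conjugating it by
`j`. -/
theorem δ_mul_vLoc (j : G) (h : H) (x : ℤ) : FLoc.δ j x * vLoc h x =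
    FLoc.δ j x * (FLoc.ρ (MulAut.conjNormal j h⁻¹) (x - 1) *
      FLoc.ρ (MulAut.conjNormal j h) x) := by
  classical
  rw [vLoc_eq, Finset.mul_sum, Finset.sum_eq_single (j * h)]
  · rw [← mul_assoc, mul_inv_cancel_right, FLoc.δ_mul_self, map_inv, map_inv,
      conjNormal_mul_self]
  · intro k _ hk
    rw [← mul_assoc, FLoc.δ_mul_ne, zero_mul]
    rintro rfl
    exact hk (by simp)
  · simp

/-- The index `j⁻¹tj` undoes the conjugation in `v`, so that the sum over `j` collapses to
`ρ_{t⁻¹}(x-1/2) ρ_t(x+1/2)`. -/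
theorem ρ_eq_sum (t : H) (x : ℤ) : FLoc.ρ t x =
    FLoc.ρ t (x - 1) * ∑ j : G, FLoc.δ j x * vLoc (MulAut.conjNormal j⁻¹ t) x := by
  have (j : G) : MulAut.conjNormal j (MulAut.conjNormal j⁻¹ t) = t := by
    rw [← MulAut.mul_apply, ← map_mul, mul_inv_cancel, map_one, MulAut.one_apply]
  simp only [δ_mul_vLoc, map_inv (MulAut.conjNormal _ : H ≃* H), this]
  rw [← Finset.sum_mul, FLoc.sum_δ, one_mul, ← mul_assoc, FLoc.ρ_mul, mul_inv_cancel, FLoc.ρ_one,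
    one_mul]

theorem commute_ρ_vLoc (t h : H) {n x : ℤ} (hn : n < x) :
    Commute (FLoc.ρ t n) (vLoc h x) := by
  rw [Commute, SemiconjBy, vLoc, Finset.mul_sum, Finset.sum_mul]
  -- Moving `ρ_t` through conjugates both `ρ` factors by `t` and translates `δ_k`, turning summand
  -- `k` into summand `tk`.
  refine Fintype.sum_equiv (Equiv.mulLeft (t : G)) _ _ fun k => ?_
  have (s : H) : MulAut.conjNormal ((t : G) * k) s = t * MulAut.conjNormal k s * t⁻¹ := by
    ext; simp [mul_assoc]
  rw [← mul_assoc, ← mul_assoc, FLoc.ρ_ρ_of_le _ _ (by omega), mul_assoc (FLoc.ρ _ _),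
    FLoc.ρ_δ_of_lt _ _ hn, mul_assoc (FLoc.ρ _ _), mul_assoc (FLoc.δ _ _), FLoc.ρ_ρ_of_le _ _ hn.le]
  simp only [Equiv.coe_mulLeft, this, mul_assoc]

theorem commute_δ_vLoc (k : G) (h : H) {n x : ℤ} (hn : n < x) :
    Commute (FLoc.δ k n) (vLoc h x) := by
  refine Commute.sum_right _ _ _ fun j _ => (Commute.mul_right ?_ ?_).mul_right ?_
  · exact (FLoc.ρ_δ_of_le _ _ (by omega)).symm
  · exact FLoc.δ_comm _ _ _ _
  · exact (FLoc.ρ_δ_of_le _ _ hn.le).symm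

/-- The only failure of commutation between `δ_m(n)` and the observables to the right of `n` occurs
at the site itself, and it is a mere translation of the index. -/
theorem δ_mul_vLoc_self (m : G) (h : H) (x : ℤ) :
    FLoc.δ m x * vLoc h x = vLoc h x * FLoc.δ (m * h) x := by
  classical
  rw [δ_mul_vLoc, vLoc, Finset.sum_mul, Finset.sum_eq_single (m * h)]
  · rw [mul_assoc _ (FLoc.ρ _ x), FLoc.ρ_δ_of_le _ _ le_rfl, mul_assoc (FLoc.ρ _ _),
      ← mul_assoc (FLoc.δ _ _) (FLoc.δ _ _),
      FLoc.δ_mul_self, ← mul_assoc (FLoc.ρ _ _),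
      FLoc.ρ_δ_of_lt _ _ (by omega), mul_assoc, map_inv, map_inv,
      conjNormal_mul_self]
    congr 2
    simp [mul_assoc]
  · intro k _ hk
    rw [mul_assoc _ (FLoc.ρ _ x), FLoc.ρ_δ_of_le _ _ le_rfl, mul_assoc (FLoc.ρ _ _),
      ← mul_assoc (FLoc.δ _ _) (FLoc.δ _ _),
      FLoc.δ_mul_ne _ hk, zero_mul, mul_zero]
  · simp

/-! ### Normal form: observables on the left, base fields on the right. -/

variable (H) in
/-- The observables `v_h(x)` and `w_g(x + 1/2)` located to the right of the site `n`, in the local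
field algebra. -/
def obsGen (n : ℤ) : Set (FLoc H) :=
  {a | ∃ (h : H) (x : ℤ), n ≤ x ∧ a = vLoc h x} ∪ {a | ∃ (g : G) (x : ℤ), n ≤ x ∧ a = wLoc g x}

variable (H) in
/-- The algebra generated by the observables to the right of the site `n`. -/
noncomputable def obsRight (n : ℤ) : Subalgebra ℂ (FLoc H) := Algebra.adjoin ℂ (obsGen H n)

theorem vLoc_mem_obsRight (h : H) {n x : ℤ} (hx : n ≤ x) : vLoc h x ∈ obsRight H n :=
  Algebra.subset_adjoin (.inl ⟨h, x, hx, rfl⟩)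

theorem wLoc_mem_obsRight (g : G) {n x : ℤ} (hx : n ≤ x) : wLoc g x ∈ obsRight H n :=
  Algebra.subset_adjoin (.inr ⟨g, x, hx, rfl⟩)

variable (H) in
/-- The span of the elements `b δ_k(n) ρ_t(n - 1/2)`, where `b` is generated by observables to the
right of `n`. -/
noncomputable def rightSpan (n : ℤ) : Submodule ℂ (FLoc H) :=
  Submodule.span ℂ {a | ∃ b ∈ obsRight H n, ∃ (k : G) (t : H),
    a = b * FLoc.δ k n * FLoc.ρ t (n - 1)}

theorem mem_rightSpan {n : ℤ} {b : FLoc H} (hb : b ∈ obsRight H n) (k : G) (t : H) :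
    b * FLoc.δ k n * FLoc.ρ t (n - 1) ∈ rightSpan H n :=
  Submodule.subset_span ⟨b, hb, k, t, rfl⟩

theorem one_mem_rightSpan (n : ℤ) : 1 ∈ rightSpan H n := by
  have : (1 : FLoc H) = ∑ k : G, 1 * FLoc.δ k n * FLoc.ρ 1 (n - 1) := by
    simp [FLoc.ρ_one, FLoc.sum_δ]
  rw [this]
  exact Submodule.sum_mem _ fun k _ => mem_rightSpan (one_mem _) k 1

theorem commute_ρ_of_mem_obsRight (t : H) {n : ℤ} {b : FLoc H} (hb : b ∈ obsRight H n) :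
    Commute (FLoc.ρ t (n - 1)) b := by
  induction hb using Algebra.adjoin_induction with
  | mem b hb =>
    obtain ⟨h, x, hx, rfl⟩ | ⟨g, x, hx, rfl⟩ := hb
    · exact commute_ρ_vLoc t h (by omega)
    · exact commute_ρ_wLoc t g (by omega)
  | algebraMap c => exact Algebra.commute_algebraMap_right c _
  | add a b _ _ ha hb => exact ha.add_right hb
  | mul a b _ _ ha hb => exact ha.mul_right hb

/-- The coefficients form a matrix over `G` attached to `b`. Treating all `m` at once lets products
of observables correspond to matrix products. -/
theorem exists_δ_mul_eq_sum {n : ℤ} {b : FLoc H} (hb : b ∈ obsRight H n) :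
    ∃ f : G → G → FLoc H, (∀ m j, f m j ∈ obsRight H n) ∧
      ∀ m, FLoc.δ m n * b = ∑ j, f m j * FLoc.δ j n := by
  classical
  -- Generators and scalars merely translate the index by a fixed `s`: `s = h` for `v_h(n)`, and `s
  -- = 1` in all other cases.
  have of_shift {b : FLoc H} (hb : b ∈ obsRight H n) (s : G)
      (h : ∀ m, FLoc.δ m n * b = b * FLoc.δ (m * s) n) :
      ∃ f : G → G → FLoc H, (∀ m j, f m j ∈ obsRight H n) ∧
        ∀ m, FLoc.δ m n * b = ∑ j, f m j * FLoc.δ j n := by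
    refine ⟨fun m j => if j = m * s then b else 0, fun m j => ?_, fun m => by simp [h, ite_mul]⟩
    dsimp only
    split_ifs
    exacts [hb, zero_mem _]
  induction hb using Algebra.adjoin_induction with
  | mem b hb =>
    obtain ⟨h, x, hx, rfl⟩ | ⟨g, x, hx, rfl⟩ := hb
    · rcases hx.eq_or_lt with rfl | hx'
      · exact of_shift (vLoc_mem_obsRight h hx) h fun m => δ_mul_vLoc_self m h n
      · exact of_shift (vLoc_mem_obsRight h hx) 1 fun m => by
          rw [mul_one]; exact commute_δ_vLoc m h hx'
    · exact of_shift (wLoc_mem_obsRight g hx) 1 fun m => by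
        rw [mul_one]; exact commute_δ_wLoc m g n x
  | algebraMap c =>
    exact of_shift (Subalgebra.algebraMap_mem _ c) 1 fun m => by
      rw [mul_one]; exact (Algebra.commutes c _).symm
  | add a b _ _ ha hb =>
    obtain ⟨f, hf, hf'⟩ := ha
    obtain ⟨f₁, hf₁, hf₁'⟩ := hb
    refine ⟨fun m j => f m j + f₁ m j, fun m j => add_mem (hf m j) (hf₁ m j), fun m => ?_⟩
    simp only [mul_add, add_mul, Finset.sum_add_distrib, hf', hf₁']
  | mul a b _ _ ha hb =>
    obtain ⟨f, hf, hf'⟩ := ha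
    obtain ⟨f₁, hf₁, hf₁'⟩ := hb
    refine ⟨fun m j => ∑ i, f m i * f₁ i j,
      fun m j => sum_mem fun i _ => mul_mem (hf m i) (hf₁ i j), fun m => ?_⟩
    simp only [← mul_assoc, hf', Finset.sum_mul]
    rw [Finset.sum_comm]
    refine Finset.sum_congr rfl fun i _ => ?_
    simp only [mul_assoc, hf₁', Finset.mul_sum]

variable (H) in
/-- The elements of the local field algebra that preserve `rightSpan H n` under left
multiplication. -/
noncomputable def rightStab (n : ℤ) : Subalgebra ℂ (FLoc H) where
  carrier := {c | ∀ a ∈ rightSpan H n, c * a ∈ rightSpan H n}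
  mul_mem' {c d} hc hd a ha := by rw [mul_assoc]; exact hc _ (hd _ ha)
  add_mem' {c d} hc hd a ha := by rw [add_mul]; exact add_mem (hc _ ha) (hd _ ha)
  algebraMap_mem' c a ha := by rw [← Algebra.smul_def]; exact Submodule.smul_mem _ c ha

theorem mem_rightStab_of_forall {n : ℤ} {c : FLoc H} (h : ∀ b ∈ obsRight H n, ∀ (k : G) (t : H),
    c * (b * FLoc.δ k n * FLoc.ρ t (n - 1)) ∈ rightSpan H n) : c ∈ rightStab H n := by
  intro a ha
  induction ha using Submodule.span_induction with
  | mem a ha => obtain ⟨b, hb, k, t, rfl⟩ := ha; exact h b hb k t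
  | zero => rw [mul_zero]; exact zero_mem _
  | add a b _ _ ha hb => rw [mul_add]; exact add_mem ha hb
  | smul r a _ ha => rw [mul_smul_comm]; exact Submodule.smul_mem _ r ha

theorem obsRight_le_rightStab (n : ℤ) : obsRight H n ≤ rightStab H n := fun c hc =>
  mem_rightStab_of_forall fun b hb k t => by
    rw [← mul_assoc, ← mul_assoc]
    exact mem_rightSpan (mul_mem hc hb) k t

theorem ρ_base_mem_rightStab (s : H) (n : ℤ) : FLoc.ρ s (n - 1) ∈ rightStab H n :=
  mem_rightStab_of_forall fun b hb k t => by
    rw [← mul_assoc, ← mul_assoc, (commute_ρ_of_mem_obsRight s hb).eq, mul_assoc b,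
      FLoc.ρ_δ_of_lt _ _ (by omega), ← mul_assoc, mul_assoc _ (FLoc.ρ _ _), FLoc.ρ_mul]
    exact mem_rightSpan hb _ _

theorem δ_base_mem_rightStab (m : G) (n : ℤ) : FLoc.δ m n ∈ rightStab H n :=
  mem_rightStab_of_forall fun b hb k t => by
    classical
    obtain ⟨f, hf, hf'⟩ := exists_δ_mul_eq_sum hb
    have : FLoc.δ m n * (b * FLoc.δ k n * FLoc.ρ t (n - 1)) =
        f m k * FLoc.δ k n * FLoc.ρ t (n - 1) := by
      rw [← mul_assoc, ← mul_assoc, hf', Finset.sum_mul]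
      -- Orthogonality of the `δ_j(n)` leaves only `j = k`.
      simp only [mul_assoc (f _ _), FLoc.δ_mul_δ]
      simp [mul_assoc]
    rw [this]
    exact mem_rightSpan (hf m k) k t

theorem δ_mem_rightStab (g : G) {n x : ℤ} (hx : n ≤ x) : FLoc.δ g x ∈ rightStab H n := by
  induction x, hx using Int.leInduction generalizing g with
  | base => exact δ_base_mem_rightStab g n
  | succ x hx ih =>
    rw [δ_succ_eq_sum]
    exact sum_mem fun j _ => mul_mem (ih j) (obsRight_le_rightStab n (wLoc_mem_obsRight _ hx))

theorem ρ_mem_rightStab (t : H) {n x : ℤ} (hx : n - 1 ≤ x) : FLoc.ρ t x ∈ rightStab H n := by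
  induction x, hx using Int.leInduction with
  | base => exact ρ_base_mem_rightStab t n
  | succ x hx ih =>
    rw [ρ_eq_sum, add_sub_cancel_right]
    exact mul_mem ih <| sum_mem fun j _ => mul_mem (δ_mem_rightStab j (by omega))
      (obsRight_le_rightStab n (vLoc_mem_obsRight _ (by omega)))

/-- Any site far enough to the left works; this uniformity supplies a common site for sums and
products. -/
theorem exists_forall_mem_rightStab (a : FLoc H) : ∃ N : ℤ, ∀ n ≤ N, a ∈ rightStab H n := by
  induction a using FLoc.induction with
  | algebraMap c => exact ⟨0, fun n _ => Subalgebra.algebraMap_mem _ c⟩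
  | delta g x => exact ⟨x, fun n hn => δ_mem_rightStab g hn⟩
  | rho h x => exact ⟨x, fun n hn => ρ_mem_rightStab h (by omega)⟩
  | mul a b ha hb =>
    obtain ⟨N, hN⟩ := ha
    obtain ⟨M, hM⟩ := hb
    exact ⟨min N M, fun n hn => mul_mem (hN n (by omega)) (hM n (by omega))⟩
  | add a b ha hb =>
    obtain ⟨N, hN⟩ := ha
    obtain ⟨M, hM⟩ := hb
    exact ⟨min N M, fun n hn => add_mem (hN n (by omega)) (hM n (by omega))⟩

theorem exists_mem_rightSpan (a : FLoc H) : ∃ n : ℤ, a ∈ rightSpan H n := by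
  obtain ⟨n, hn⟩ := exists_forall_mem_rightStab a
  exact ⟨n, by simpa using hn n le_rfl 1 (one_mem_rightSpan n)⟩

/-! ### Invariant elements -/

open Classical in
variable (H) in
/-- The `D(H;G)`-invariant elements of the local field algebra. -/
noncomputable def invLoc : StarSubalgebra ℂ (FLoc H) where
  carrier := {a | ∀ (h : H) (g : G), actLoc h g a = if h = 1 then a else 0}
  mul_mem' {a b} ha hb h g := by
    let _ : Fintype H := Fintype.ofFinite H
    rw [actLoc_mul]
    -- Invariance of the left factor kills every term of the coproduct sum except `t = 1`.
    simp only [ha _ g, hb _ g, ite_mul, zero_mul, Finset.sum_ite_eq', Finset.mem_univ, if_true]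
    simp
  add_mem' {a b} ha hb h g := by
    rw [map_add, ha, hb]
    split_ifs <;> simp
  algebraMap_mem' c h g := actLoc_algebraMap h g c
  star_mem' {a} ha h g := by
    rw [actLoc_star, ha]
    simp only [inv_eq_one]
    split_ifs <;> simp

open Classical in
theorem mem_invLoc {a : FLoc H} :
    a ∈ invLoc H ↔ ∀ (h : H) (g : G), actLoc h g a = if h = 1 then a else 0 := Iff.rfl

theorem actLoc_δ_mul (h : H) (g f : G) (x : ℤ) (a : FLoc H) :
    actLoc h g (FLoc.δ f x * a) = FLoc.δ (g * f) x * actLoc h g a := by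
  classical
  let _ : Fintype H := Fintype.ofFinite H
  simp [actLoc_mul, actLoc_δ, ite_mul]

theorem actLoc_ρ_mul (h : H) (g : G) (t : H) (n : ℤ) (a : FLoc H) :
    actLoc h g (FLoc.ρ t n * a) = FLoc.ρ (MulAut.conjNormal g t) n *
      actLoc ((MulAut.conjNormal g t)⁻¹ * h) g a := by
  classical
  let _ : Fintype H := Fintype.ofFinite H
  simp [actLoc_mul, actLoc_ρ, ← MulAut.conjNormal_apply, ite_mul]

/-- This makes averaging linear over the invariants, like a conditional expectation. -/
theorem actLoc_inv_mul {b : FLoc H} (hb : b ∈ invLoc H) (h : H) (g : G) (a : FLoc H) :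
    actLoc h g (b * a) = b * actLoc h g a := by
  classical
  let _ : Fintype H := Fintype.ofFinite H
  simp [actLoc_mul, mem_invLoc.1 hb, ite_mul]

theorem wLoc_mem_invLoc (g : G) (n : ℤ) : wLoc g n ∈ invLoc H := by
  classical
  intro h f
  simp only [wLoc, map_sum, actLoc_δ_mul, actLoc_δ]
  split_ifs
  · exact Fintype.sum_equiv (Equiv.mulLeft f) _ _ fun k => by simp [mul_assoc]
  · simp

theorem vLoc_mem_invLoc (t : H) (x : ℤ) : vLoc t x ∈ invLoc H := by
  classical
  intro h f
  simp only [vLoc, map_sum, actLoc_δ_mul, actLoc_ρ_mul, actLoc_ρ, mul_assoc]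
  -- The two `ρ` factors of a summand carry mutually inverse elements of `H`, so only `h = 1` acts
  -- nontrivially; `f` then permutes the summands.
  have key (k : G) : (((MulAut.conjNormal f (MulAut.conjNormal k t⁻¹))⁻¹ * h : H) : G) =
      f * ((MulAut.conjNormal k t : H) * f⁻¹) ↔ h = 1 := by
    rw [← mul_assoc, ← MulAut.conjNormal_apply, ← Subtype.ext_iff]
    simp
  simp only [key]
  split_ifs with hh
  · refine Fintype.sum_equiv (Equiv.mulLeft f) _ _ fun k => ?_
    simp [hh]
  · simp

theorem obsRight_le_invLoc (n : ℤ) : obsRight H n ≤ (invLoc H).toSubalgebra := by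
  refine Algebra.adjoin_le ?_
  rintro _ (⟨h, x, -, rfl⟩ | ⟨g, x, -, rfl⟩)
  exacts [vLoc_mem_invLoc h x, wLoc_mem_invLoc g x]

/-- Averaging over `D(H;G)` maps the local field algebra to the algebra generated by the local
observables. -/
theorem exists_sum_actLoc_mem_obsRight (a : FLoc H) :
    ∃ n : ℤ, ∑ g, actLoc 1 g a ∈ obsRight H n := by
  classical
  obtain ⟨n, hn⟩ := exists_mem_rightSpan a
  refine ⟨n, ?_⟩
  induction hn using Submodule.span_induction with
  | mem a ha =>
    obtain ⟨b, hb, k, t, rfl⟩ := ha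
    simp only [mul_assoc, actLoc_inv_mul (obsRight_le_invLoc n hb), actLoc_δ_mul, actLoc_ρ]
    rw [← Finset.mul_sum]
    refine mul_mem hb ?_
    have key (g : G) : ((1 : H) : G) = g * ((t : G) * g⁻¹) ↔ t = 1 := by
      rw [← mul_assoc, ← MulAut.conjNormal_apply, ← Subtype.ext_iff, eq_comm]
      simp
    simp only [key]
    split_ifs
    -- As `g` varies, `gk` runs over all of `G`, so the `δ_{gk}(n)` sum to `1`.
    · have := Equiv.sum_comp (Equiv.mulRight k) fun g => (FLoc.δ g n : FLoc H)
      simp only [Equiv.coe_mulRight, FLoc.sum_δ] at this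
      simp [FLoc.ρ_one, this]
    · simp
  | zero => simp
  | add a b _ _ ha hb => simpa [Finset.sum_add_distrib] using add_mem ha hb
  | smul r a _ ha => simpa [← Finset.smul_sum] using Subalgebra.smul_mem _ ha r

/-! ### The observable algebra -/

theorem mem_observables_iff {F : FieldAlgebra H} : F ∈ observables H ↔
    ∀ (h : H) (g : G), act h g F = D.counit (D.basis H (h, g)) • F := by
  refine ⟨fun hF h g => by rw [← γ_basis]; exact hF _, fun hF a => ?_⟩
  induction a using D.induction with
  | add a b ha hb => rw [map_add, map_add, add_smul, ← ha, ← hb]; rfl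
  | smul c a ha => rw [map_smul, map_smul, smul_assoc, ← ha]; rfl
  | basis h g => rw [γ_basis]; exact hF h g

variable (H) in
theorem isClosed_observables : IsClosed (observables H) := by
  have : observables H =
      ⋂ a : D H, {F : FieldAlgebra H | γ a F = D.counit a • F} := by
    rw [observables, Set.ofPred_forall]
  rw [this]
  exact isClosed_iInter fun a => isClosed_eq (γ a).continuous (continuous_const_smul _)

theorem of_mem_observables {a : FLoc H} (ha : a ∈ invLoc H) :
    FieldAlgebra.of a ∈ observables H := by
  classical
  rw [mem_observables_iff]
  intro h g
  rw [act_of, mem_invLoc.1 ha, D.counit_basis]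
  split_ifs <;> simp

/-- Each `(1, g)` has counit `1` and therefore fixes `F`. -/
theorem card_smul_eq_sum_act {F : FieldAlgebra H} (hF : F ∈ observables H) :
    (Fintype.card G : ℂ) • F = ∑ g, act (1 : H) g F := by
  simp [mem_observables_iff.1 hF, D.counit_basis, Nat.cast_smul_eq_nsmul]

variable (H) in
/-- The unital `⋆`-subalgebra of the field algebra generated by the elements `v_h(x)` and
`w_g(l)`. -/
noncomputable abbrev obsAdjoin : StarSubalgebra ℂ (FieldAlgebra H) :=
  StarAlgebra.adjoin ℂ
    ({F | ∃ (h : H) (x : ℤ), F = v h x} ∪ {F | ∃ (g : G) (n : ℤ), F = w g n})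

/-- Before closure, everything generated comes from local invariants, where the action is explicit.
The star structure on `invLoc` handles adjoints. -/
theorem obsAdjoin_le_map_invLoc : obsAdjoin H ≤ (invLoc H).map (FieldAlgebra.ofStar H) := by
  refine StarAlgebra.adjoin_le ?_
  rintro _ (⟨h, x, rfl⟩ | ⟨g, x, rfl⟩)
  exacts [⟨_, vLoc_mem_invLoc h x, of_vLoc h x⟩, ⟨_, wLoc_mem_invLoc g x, of_wLoc g x⟩]

theorem of_mem_obsAdjoin {n : ℤ} {a : FLoc H} (ha : a ∈ obsRight H n) :
    FieldAlgebra.of a ∈ obsAdjoin H := by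
  suffices obsRight H n ≤ (obsAdjoin H).toSubalgebra.comap FieldAlgebra.of from this ha
  refine Algebra.adjoin_le ?_
  rintro _ (⟨h, x, -, rfl⟩ | ⟨g, x, -, rfl⟩)
  · exact StarAlgebra.subset_adjoin ℂ _ (.inl ⟨h, x, of_vLoc h x⟩)
  · exact StarAlgebra.subset_adjoin ℂ _ (.inr ⟨g, x, of_wLoc g x⟩)

theorem sum_act_mem_topologicalClosure (F : FieldAlgebra H) :
    ∑ g, act (1 : H) g F ∈ (obsAdjoin H).topologicalClosure := by
  induction F using FieldAlgebra.induction with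
  | hc =>
    exact (obsAdjoin H).isClosed_topologicalClosure.preimage
      (f := fun F => ∑ g, act (1 : H) g F) (by fun_prop)
  | h a =>
    obtain ⟨n, hn⟩ := exists_sum_actLoc_mem_obsRight a
    simp only [act_of, ← map_sum]
    exact (obsAdjoin H).le_topologicalClosure (of_mem_obsAdjoin hn)

end

end GSpin

/-- The observable algebra is the unital C⋆-subalgebra of the field algebra generated by the
elements `v_h(x)` and `w_g(l)`; the half-integer `l = n + 1/2` is indexed by the integer `n`. -/
theorem theorem2p1 {G : Type*} [Group G] [Fintype G] (H : Subgroup G) [H.Normal] :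
    GSpin.observables H =
      ((StarAlgebra.adjoin ℂ
        ({F | ∃ (h : H) (x : ℤ), F = GSpin.v h x} ∪ {F | ∃ (g : G) (n : ℤ), F = GSpin.w g n} :
          Set (GSpin.FieldAlgebra H))).topologicalClosure : Set (GSpin.FieldAlgebra H)) := by
  refine Set.Subset.antisymm (fun F hF => ?_) ?_
  · have h := GSpin.sum_act_mem_topologicalClosure F
    rw [← GSpin.card_smul_eq_sum_act hF] at h
    -- Normalise the average: `|G|` is invertible in `ℂ`, which recovers `F` itself.
    have h' := SMulMemClass.smul_mem (Fintype.card G : ℂ)⁻¹ h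
    rwa [inv_smul_smul₀ (Nat.cast_ne_zero.2 Fintype.card_ne_zero)] at h'
  · rw [StarSubalgebra.topologicalClosure_coe]
    refine closure_minimal (fun F hF => ?_) (GSpin.isClosed_observables H)
    obtain ⟨a, ha, rfl⟩ := GSpin.obsAdjoin_le_map_invLoc hF
    exact GSpin.of_mem_observables ha
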